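/- Let $V_8$ be the Vámos cube, i.e. the matroid on $\{1,\dots,8\}$ whose bases are all four-element subsets except $\{1,2,3,4\}$, $\{1,4,5,6\}$, $\{1,4,7,8\}$, $\{2,3,5,6\}$ and $\{2,3,7,8\}$. Let $h_{V_8}(x)=\sum_{B}\prod_{j\in B}x_j\in\mathbb{R}[x_1,\dots,x_8]$, the sum being over all bases $B$ of $V_8$, be its bases generating polynomial, and let $p(x)=h_{V_8}(x_1+1,\dots,x_8+1)$. Then: (1) $p$ is a real zero polynomial: for all $x\in\mathbb{R}^8$ and $\mu\in\mathbb{C}$, $p(\mu x)=0$ implies that $\mu$ is real. (2) For every integer $N\ge 1$, the power $p^N$ has no determinantal representation, not even up to a scalar: for no $c\in\mathbb{R}$ are there an $m\ge 0$ and complex hermitian (or real symmetric) $m\times m$ matrices $A_1,\dots,A_8$ with $$c\,p(x)^N=\det(I+x_1A_1+\cdots+x_8A_8).$$ In particular this holds for the normalized power $(p/p(0))^N$, which has value $1$ at the origin. (3) Consequently the following relaxed Helton–Vinnikov conjecture is false: for every $n$ and every real zero polynomial $q\in\mathbb{R}[x_1,\dots,x_n]$ with $q(0)=1$ there are a positive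 integer $N$ and real symmetric matrices $A_1,\dots,A_n$ of a common size such that $q(x)^N=\det(I+x_1A_1+\cdots+x_nA_n)$. -/

import Mathlib

noncomputable section

open MvPolynomial

/-- The list of the five four-element circuits of the Vámos cube. The elements `1, …, 8` of its
usual ground set are written here as `0, …, 7`, so that these are `1234`, `1456`, `1478`, `2356`
and `2378` in the usual labelling: the five coplanar quadruples of the picture. -/
def vamosPlanes : Finset (Finset (Fin 8)) :=
  {{0, 1, 2, 3}, {0, 3, 4, 5}, {0, 3, 6, 7}, {1, 2, 4, 5}, {1, 2, 6, 7}}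

/-- The bases of the Vámos cube: all quadruples that are not coplanar. -/
def IsVamosBasis (B : Set (Fin 8)) : Prop :=
  B.ncard = 4 ∧ ∀ P ∈ vamosPlanes, B ≠ (P : Set (Fin 8))

theorem vamosPlanes_inter :
    ∀ P ∈ vamosPlanes, ∀ Q ∈ vamosPlanes, P ≠ Q → (P ∩ Q).card ≤ 2 := by
  decide +kernel

theorem exists_isVamosBasis : ∃ B, IsVamosBasis B := by
  refine ⟨(({4, 5, 6, 7} : Finset (Fin 8)) : Set (Fin 8)), ?_, ?_⟩
  · rw [Set.ncard_coe_finset]; decide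
  · intro P hP h
    have h' := Finset.coe_injective h
    rw [← h'] at hP
    exact absurd hP (by decide)

theorem isVamosBasis_exchange : Matroid.ExchangeProperty IsVamosBasis := by
  classical
  intro X Y hX hY a ha
  obtain ⟨haX, haY⟩ := ha
  have hcard : ∀ b ∈ Y \ X, (insert b (X \ {a})).ncard = 4 := by
    intro b hb
    rw [Set.ncard_insert_of_notMem (fun h => hb.2 h.1), Set.ncard_sdiff_singleton_of_mem haX, hX.1]
  have hXY : (Y \ X).ncard = (X \ Y).ncard := by
    have h1 := Set.ncard_inter_add_ncard_sdiff_eq_ncard X Y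
    have h2 := Set.ncard_inter_add_ncard_sdiff_eq_ncard Y X
    rw [Set.inter_comm] at h2
    have h3 := hX.1
    have h4 := hY.1
    omega
  have hpos : 0 < (Y \ X).ncard := by
    rw [hXY]
    exact (Set.ncard_pos).2 ⟨a, haX, haY⟩
  by_contra! hcon
  have hplane : ∀ b ∈ Y \ X, ∃ P ∈ vamosPlanes, insert b (X \ {a}) = (P : Set (Fin 8)) := by
    intro b hb
    have := hcon b hb
    by_contra! h
    exact this ⟨hcard b hb, h⟩
  obtain hone | htwo : (Y \ X).ncard = 1 ∨ 1 < (Y \ X).ncard := by omega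
  · obtain ⟨b, hb⟩ := Set.ncard_eq_one.1 hone
    obtain ⟨a', ha'⟩ := Set.ncard_eq_one.1 (hXY ▸ hone)
    have hbm : b ∈ Y \ X := hb ▸ Set.mem_singleton b
    have haa : a = a' := by
      have : a ∈ X \ Y := ⟨haX, haY⟩
      rw [ha'] at this
      exact this
    subst haa
    obtain ⟨P, hP, hPe⟩ := hplane b hbm
    refine hY.2 P hP (hPe ▸ ?_)
    symm
    apply Set.eq_of_subset_of_ncard_le _ _ (Set.toFinite _)
    · intro z hz
      rcases hz with rfl | ⟨hzX, hza⟩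
      · exact hbm.1
      · by_contra hzY
        have : z ∈ X \ Y := ⟨hzX, hzY⟩
        rw [ha'] at this
        exact hza this
    · rw [hcard b hbm, hY.1]
  · obtain ⟨b, c, hb, hc, hbc⟩ := (Set.one_lt_ncard_iff (Set.toFinite _)).1 htwo
    obtain ⟨P, hP, hPe⟩ := hplane b hb
    obtain ⟨Q, hQ, hQe⟩ := hplane c hc
    have hne : P ≠ Q := by
      rintro rfl
      have : b ∈ insert c (X \ {a}) := by rw [hQe, ← hPe]; exact Set.mem_insert _ _
      rcases this with h | h
      · exact hbc h
      · exact hb.2 h.1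
    have hle := vamosPlanes_inter P hP Q hQ hne
    have hsub : X \ {a} ⊆ ((P ∩ Q : Finset (Fin 8)) : Set (Fin 8)) := by
      rw [Finset.coe_inter, ← hPe, ← hQe]
      exact Set.subset_inter (Set.subset_insert _ _) (Set.subset_insert _ _)
    have h3 := Set.ncard_le_ncard hsub (Set.toFinite _)
    rw [Set.ncard_coe_finset, Set.ncard_sdiff_singleton_of_mem haX, hX.1] at h3
    omega

/-- The Vámos cube `V₈`, as a matroid on eight elements. -/
def vamosCube : Matroid (Fin 8) :=
  Matroid.ofIsBaseOfFinite (E := Set.univ) Set.finite_univ IsVamosBasis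
    exists_isVamosBasis isVamosBasis_exchange (fun B _ => Set.subset_univ B)

open scoped Classical in
/-- The bases generating polynomial `h_M = ∑_B ∏_{j ∈ B} x_j` of a matroid on a finite type. -/
def basesGeneratingPolynomial {σ : Type*} [Fintype σ] (M : Matroid σ) : MvPolynomial σ ℝ :=
  ∑ B : Finset σ with M.IsBase (B : Set σ), ∏ j ∈ B, X j

/-- The polynomial `h_{V₈}(x₁ + 1, …, x₈ + 1)`. -/
def shiftedVamosPolynomial : MvPolynomial (Fin 8) ℝ :=
  bind₁ (fun i => X i + 1) (basesGeneratingPolynomial vamosCube)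

/-- Real zero polynomials: for real `x` and complex `μ`, if `p (μ x) = 0` then `μ` is real. -/
def IsRealZero {σ : Type*} (p : MvPolynomial σ ℝ) : Prop :=
  ∀ (x : σ → ℝ) (μ : ℂ), aeval (fun i => μ * (x i : ℂ)) p = 0 → μ.im = 0

/-- The polynomial `det (I + ∑ᵢ xᵢ Aᵢ)` of a tuple of `m × m` matrices over `R`. -/
def detPencil {n m : ℕ} {R : Type*} [CommRing R] (A : Fin n → Matrix (Fin m) (Fin m) R) :
    MvPolynomial (Fin n) R :=
  (1 + ∑ i, (X i : MvPolynomial (Fin n) R) • (A i).map C).det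

/-- `q = det (I + ∑ᵢ xᵢ Aᵢ)` for real symmetric matrices `Aᵢ` of some common size. -/
def HasSymmetricDetRep {n : ℕ} (q : MvPolynomial (Fin n) ℝ) : Prop :=
  ∃ (m : ℕ) (A : Fin n → Matrix (Fin m) (Fin m) ℝ), (∀ i, (A i).IsSymm) ∧ q = detPencil A

/-- `q = det (I + ∑ᵢ xᵢ Aᵢ)` for complex hermitian matrices `Aᵢ` of some common size. -/
def HasHermitianDetRep {n : ℕ} (q : MvPolynomial (Fin n) ℝ) : Prop :=
  ∃ (m : ℕ) (A : Fin n → Matrix (Fin m) (Fin m) ℂ),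
    (∀ i, (A i).IsHermitian) ∧ q.map (algebraMap ℝ ℂ) = detPencil A

/-- The relaxed Helton–Vinnikov conjecture: every real zero polynomial `p` with `p (0) = 1` has a
positive power that is a determinant `det (I + ∑ᵢ xᵢ Aᵢ)` with real symmetric `Aᵢ`. -/
def RelaxedHeltonVinnikovConjecture : Prop :=
  ∀ (n : ℕ) (p : MvPolynomial (Fin n) ℝ), IsRealZero p → eval 0 p = 1 →
    ∃ N : ℕ, 0 < N ∧ HasSymmetricDetRep (p ^ N)

end

/-! Two independent arguments are made, both on the four-variable form `F = pairedVamos`, which the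
basis polynomial becomes when the variables agree on the four pairs.

Real zeros. The basis polynomial `vamosForm` has no zero with all coordinates in the upper
half-plane. It is symmetric and affine in each pair, so the two-variable Grace–Walsh–Szegő theorem
replaces each pair by a single point and reduces the claim to `F`. As a quadratic in `a`, `F` has
leading coefficient `4q`, where `q = bc + bd + cd`, and nonnegative discriminant
(`pairedVamos_discrim_nonneg`). Along a line with positive direction, the cubic `K` with `∂F/∂a =
4K` has three roots separated by the two roots of `q`. Since `q F ≤ 0` there, `F` changes sign often
enough to have four real roots. By homogeneity, stability gives the real zero property of the
shifted polynomial.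

No representation. A determinantal representation of a multiple of the `N`-th power, restricted to
the pairs, gives positive semidefinite matrices `A, B, C, D`. The rank of a sum of some of them is
`N` times the degree of `F` in the corresponding variables. The kernel of such a sum is the
intersection of the kernels, so Ingleton's inequality constrains these ranks, and the Vámos degrees
violate it for every `N ≥ 1`. -/

/-- The restriction of the bases generating polynomial of the Vámos cube to the subspace where the
variables agree on each of the pairs `{0, 3}`, `{1, 2}`, `{4, 5}`, `{6, 7}`. -/
def pairedVamos {R : Type*} [CommRing R] (a b c d : R) : R :=
  4 * (a + b + c + d) * (a * b * c + a * b * d + a * c * d + b * c * d) + c ^ 2 * d ^ 2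

/-- Up to a factor 16, the difference of the two sides is the discriminant of `pairedVamos` as a
quadratic in `a`. -/
theorem pairedVamos_discrim_nonneg (b c d : ℝ) :
    (b * c + b * d + c * d) * (c ^ 2 * d ^ 2) ≤ ((b + c) * (b + d) * (c + d)) ^ 2 := by
  obtain ⟨p, hp⟩ : ∃ p, p = c * d := ⟨_, rfl⟩
  obtain ⟨s, hs⟩ : ∃ s, s = c + d := ⟨_, rfl⟩
  obtain ⟨q, hq⟩ : ∃ q, q = b * s + p := ⟨_, rfl⟩
  have hsp : 4 * p ≤ s ^ 2 := by rw [hp, hs]; nlinarith [sq_nonneg (c - d)]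
  -- Here `(b + c)(b + d) = b² + q`. For `q > 0`, the right side dominates `4q(q - p)²` by AM-GM,
  -- and `4pq²` if also `p > 0`. The second bound settles `0 < p ≤ 4q`; the first settles the other
  -- cases.
  have key : q * p ^ 2 ≤ s ^ 2 * (b ^ 2 + q) ^ 2 := by
    rcases le_or_gt q 0 with h | hq0
    · exact (mul_nonpos_of_nonpos_of_nonneg h (sq_nonneg p)).trans (by positivity)
    have h1 : 4 * q * (q - p) ^ 2 ≤ s ^ 2 * (b ^ 2 + q) ^ 2 := by
      have : q - p = b * s := by rw [hq]; ring
      rw [this]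
      nlinarith [mul_nonneg (sq_nonneg s) (sq_nonneg (b ^ 2 - q))]
    rcases le_or_gt p 0 with hp0 | hp0
    · nlinarith [mul_nonneg hq0.le (sq_nonneg q), mul_nonneg hq0.le (sq_nonneg p),
        mul_nonneg hq0.le (mul_nonneg hq0.le (neg_nonneg.2 hp0))]
    rcases le_or_gt p (4 * q) with h4 | h4
    · have h2 : 4 * p * q ^ 2 ≤ s ^ 2 * (b ^ 2 + q) ^ 2 := by
        apply mul_le_mul hsp _ (by positivity) (by positivity)
        nlinarith [sq_nonneg b]
      nlinarith [mul_nonneg (mul_pos hq0 hp0).le (sub_nonneg.2 h4)]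
    · nlinarith [mul_nonneg hq0.le (mul_nonneg hp0.le (sub_nonneg.2 h4.le)),
        mul_nonneg hq0.le (sq_nonneg q), mul_nonneg hq0.le (sq_nonneg p)]
  have e1 : b * c + b * d + c * d = q := by rw [hq, hs, hp]; ring
  have e2 : ((b + c) * (b + d) * (c + d)) ^ 2 = s ^ 2 * (b ^ 2 + q) ^ 2 := by
    rw [hq, hs, hp]; ring
  rw [e1, e2, ← mul_pow, ← hp]
  exact key

/-! ### Real polynomials of low degree with prescribed signs -/

open Polynomial in
theorem Polynomial.exists_eq_C_mul_of_natDegree_two {Q : ℝ[X]} (hQ : Q.natDegree = 2)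
    (hL : 0 < Q.leadingCoeff) {s : ℝ} (hs : Q.eval s < 0) :
    ∃ r₁ r₂, r₁ < s ∧ s < r₂ ∧ Q = C Q.leadingCoeff * ((X - C r₁) * (X - C r₂)) := by
  have hE := Q.as_sum_range_C_mul_X_pow
  simp only [hQ, Finset.sum_range_succ, Finset.sum_range_zero, zero_add, pow_zero, pow_one,
    mul_one] at hE
  have hl : Q.leadingCoeff = Q.coeff 2 := by rw [leadingCoeff, hQ]
  rw [hl] at hL ⊢
  generalize Q.coeff 2 = l at *
  generalize Q.coeff 1 = m at *
  generalize Q.coeff 0 = n at *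
  have hl0 : l ≠ 0 := hL.ne'
  subst hE
  simp only [eval_add, eval_mul, eval_C, eval_X, eval_pow] at hs
  have hD : (2 * l * s + m) ^ 2 < m ^ 2 - 4 * l * n := by nlinarith
  have hD0 : 0 ≤ m ^ 2 - 4 * l * n := (sq_nonneg _).trans hD.le
  have hw := Real.sq_sqrt hD0
  have habs := (Real.lt_sqrt (abs_nonneg _)).2 ((sq_abs (2 * l * s + m)).trans_lt hD)
  generalize √(m ^ 2 - 4 * l * n) = w at *
  rw [abs_lt] at habs
  refine ⟨(-m - w) / (2 * l), (-m + w) / (2 * l), ?_, ?_, ?_⟩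
  · rw [div_lt_iff₀ (by positivity)]; linarith
  · rw [lt_div_iff₀ (by positivity)]; linarith
  · have h1 : m = -l * ((-m - w) / (2 * l) + (-m + w) / (2 * l)) := by field_simp; ring
    have h2 : n = l * ((-m - w) / (2 * l) * ((-m + w) / (2 * l))) := by
      field_simp; linarith
    generalize (-m - w) / (2 * l) = r₁ at *
    generalize (-m + w) / (2 * l) = r₂ at *
    rw [h1, h2]
    simp only [C_mul, C_add, C_neg]
    ring

open Polynomial in
theorem Polynomial.exists_mul_eq_of_sign_change {P : ℝ[X]} {s t : ℝ} (hst : s < t)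
    (h : P.eval s * P.eval t < 0) :
    ∃ r Q, s < r ∧ r < t ∧ P = (X - C r) * Q := by
  have hr : ∃ r ∈ Set.Ioo s t, P.eval r = 0 := by
    rcases mul_neg_iff.1 h with ⟨h1, h2⟩ | ⟨h1, h2⟩
    · exact intermediate_value_Ioo' hst.le P.continuous.continuousOn ⟨h2, h1⟩
    · exact intermediate_value_Ioo hst.le P.continuous.continuousOn ⟨h1, h2⟩
  obtain ⟨r, ⟨h1, h2⟩, h3⟩ := hr
  obtain ⟨Q, hQ⟩ := dvd_iff_isRoot.2 h3
  exact ⟨r, Q, h1, h2, hQ⟩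

open Polynomial in
theorem Polynomial.natDegree_and_leadingCoeff_of_eq_X_sub_C_mul {P Q : ℝ[X]} {r : ℝ} {n : ℕ}
    (hP : P.natDegree = n + 1) (h : P = (X - C r) * Q) :
    Q.natDegree = n ∧ P.leadingCoeff = Q.leadingCoeff := by
  have hQ : Q ≠ 0 := by rintro rfl; simp [h] at hP
  refine ⟨?_, by rw [h]; simp⟩
  rw [h, natDegree_mul (X_sub_C_ne_zero r) hQ, natDegree_X_sub_C] at hP
  omega

open Polynomial in
theorem Polynomial.exists_roots_of_natDegree_three {K : ℝ[X]} (hK : K.natDegree = 3)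
    (hL : 0 < K.leadingCoeff) {s₁ s₂ : ℝ} (hs : s₁ < s₂) (h1 : 0 < K.eval s₁)
    (h2 : K.eval s₂ < 0) :
    ∃ t₁ t₂ t₃, t₁ < s₁ ∧ s₁ < t₂ ∧ t₂ < s₂ ∧ s₂ < t₃ ∧
      K.eval t₁ = 0 ∧ K.eval t₂ = 0 ∧ K.eval t₃ = 0 := by
  obtain ⟨r, Q, hr1, hr2, hQ⟩ := exists_mul_eq_of_sign_change hs (mul_neg_of_pos_of_neg h1 h2)
  obtain ⟨hd, hl⟩ := natDegree_and_leadingCoeff_of_eq_X_sub_C_mul hK hQ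
  have e (z : ℝ) : K.eval z = (z - r) * Q.eval z := by rw [hQ]; simp
  rw [e] at h1 h2
  have g1 : Q.eval s₁ < 0 := by
    by_contra! h
    nlinarith
  have g2 : Q.eval s₂ < 0 := by
    by_contra! h
    nlinarith
  rw [hl] at hL
  obtain ⟨u, v, hu, hv, huv⟩ := exists_eq_C_mul_of_natDegree_two hd hL g1
  have hv2 : s₂ < v := by
    by_contra! h
    rw [huv] at g2
    simp only [eval_mul, eval_C, eval_sub, eval_X] at g2
    have : 0 ≤ Q.leadingCoeff * ((s₂ - u) * (s₂ - v)) :=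
      mul_nonneg hL.le (mul_nonneg (by linarith) (by linarith))
    linarith
  refine ⟨u, r, v, hu, hr1, hr2, hv2, ?_, ?_, ?_⟩
  · rw [e, huv]; simp
  · rw [e]; simp
  · rw [e, huv]; simp

theorem Complex.abs_im_le_norm_sub_ofReal (z : ℂ) (r : ℝ) : |z.im| ≤ ‖z - r‖ := by
  simpa using Complex.abs_im_le_norm (z - r)

-- The signs force four real roots, and each factor `z - r` has norm at least `|Im z|`. Unlike mere
-- nonvanishing, this bound survives limits of polynomials.
open Polynomial in
theorem Polynomial.le_norm_aeval_of_sign_changes {P : ℝ[X]} (hP : P.natDegree = 4)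
    (hL : 0 < P.leadingCoeff) {t₁ t₂ t₃ : ℝ} (h12 : t₁ < t₂) (h23 : t₂ < t₃)
    (h1 : P.eval t₁ < 0) (h2 : 0 < P.eval t₂) (h3 : P.eval t₃ < 0) (z : ℂ) :
    P.leadingCoeff * |z.im| ^ 4 ≤ ‖aeval z P‖ := by
  obtain ⟨r, Q, hr1, hr2, hQ⟩ := exists_mul_eq_of_sign_change h12 (mul_neg_of_neg_of_pos h1 h2)
  obtain ⟨hd, hl⟩ := natDegree_and_leadingCoeff_of_eq_X_sub_C_mul hP hQ
  have e (z : ℝ) : P.eval z = (z - r) * Q.eval z := by rw [hQ]; simp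
  rw [e] at h1 h2 h3
  have g1 : 0 < Q.eval t₁ := by by_contra! h; nlinarith
  have g2 : 0 < Q.eval t₂ := by by_contra! h; nlinarith
  have g3 : Q.eval t₃ < 0 := by by_contra! h; nlinarith
  obtain ⟨r', Q', hr1', hr2', hQ'⟩ :=
    exists_mul_eq_of_sign_change h23 (mul_neg_of_pos_of_neg g2 g3)
  obtain ⟨hd', hl'⟩ := natDegree_and_leadingCoeff_of_eq_X_sub_C_mul hd hQ'
  have g1' : Q'.eval t₁ < 0 := by
    rw [hQ'] at g1
    simp only [eval_mul, eval_C, eval_sub, eval_X] at g1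
    by_contra! h
    nlinarith
  rw [hl, hl'] at hL
  obtain ⟨u, v, -, -, huv⟩ := exists_eq_C_mul_of_natDegree_two hd' hL g1'
  have hfac : aeval z P = (z - r) * ((z - r') * (Q'.leadingCoeff * ((z - u) * (z - v)))) := by
    rw [hQ, hQ', huv]; simp
  rw [hfac, hl, hl']
  simp only [norm_mul, Complex.norm_real, Real.norm_eq_abs, abs_of_pos hL]
  have := Complex.abs_im_le_norm_sub_ofReal z
  calc Q'.leadingCoeff * |z.im| ^ 4
      = |z.im| * (|z.im| * (Q'.leadingCoeff * (|z.im| * |z.im|))) := by ring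
    _ ≤ _ := by gcongr <;> apply this

/-! ### Stability of the four-variable form -/

open Polynomial in
theorem le_norm_pairedVamos_line_of_ne {xa xb xc xd ya yb yc yd : ℝ} (ha : 0 < ya) (hb : 0 < yb)
    (hc : 0 < yc) (hd : 0 < yd) (hbc : xb * yc ≠ xc * yb)
    (hbd : xb * yd ≠ xd * yb) (hcd : xc * yd ≠ xd * yc) (z : ℂ) :
    pairedVamos ya yb yc yd * |z.im| ^ 4 ≤
      ‖pairedVamos ((xa : ℂ) + ya * z) (xb + yb * z) (xc + yc * z) (xd + yd * z)‖ := by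
  obtain ⟨pa, hpa⟩ : ∃ p : ℝ[X], p = C xa + C ya * X := ⟨_, rfl⟩
  obtain ⟨pb, hpb⟩ : ∃ p : ℝ[X], p = C xb + C yb * X := ⟨_, rfl⟩
  obtain ⟨pc, hpc⟩ : ∃ p : ℝ[X], p = C xc + C yc * X := ⟨_, rfl⟩
  obtain ⟨pd, hpd⟩ : ∃ p : ℝ[X], p = C xd + C yd * X := ⟨_, rfl⟩
  obtain ⟨q, hq⟩ : ∃ q : ℝ[X], q = pb * pc + pb * pd + pc * pd := ⟨_, rfl⟩
  obtain ⟨K, hK⟩ : ∃ K : ℝ[X], K = 2 * (pb * pc + pb * pd + pc * pd) * pa +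
    (pb + pc + pd) * (pb * pc + pb * pd + pc * pd) + pb * pc * pd := ⟨_, rfl⟩
  obtain ⟨F, hF⟩ : ∃ F : ℝ[X], F = pairedVamos pa pb pc pd := ⟨_, rfl⟩
  have hq2 : q.coeff 2 = yb * yc + yb * yd + yc * yd := by
    rw [hq, hpb, hpc, hpd]; compute_degree!
  have hqd : q.natDegree ≤ 2 := by rw [hq, hpb, hpc, hpd]; compute_degree!
  have hK3 : K.coeff 3 = 2 * (yb * yc + yb * yd + yc * yd) * ya +
      (yb + yc + yd) * (yb * yc + yb * yd + yc * yd) + yb * yc * yd := by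
    rw [hK, hpa, hpb, hpc, hpd]; compute_degree!
  have hKd : K.natDegree ≤ 3 := by rw [hK, hpa, hpb, hpc, hpd]; compute_degree!
  have hF4 : F.coeff 4 = pairedVamos ya yb yc yd := by
    rw [hF, pairedVamos, hpa, hpb, hpc, hpd]; compute_degree!
  have hFd : F.natDegree ≤ 4 := by rw [hF, pairedVamos, hpa, hpb, hpc, hpd]; compute_degree!
  have hq2pos : 0 < q.coeff 2 := by rw [hq2]; positivity
  have hK3pos : 0 < K.coeff 3 := by rw [hK3]; positivity
  have hF4pos : 0 < F.coeff 4 := by rw [hF4, pairedVamos]; positivity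
  have hqd' : q.natDegree = 2 := natDegree_eq_of_le_of_coeff_ne_zero hqd hq2pos.ne'
  have hKd' : K.natDegree = 3 := natDegree_eq_of_le_of_coeff_ne_zero hKd hK3pos.ne'
  have hql : q.leadingCoeff = q.coeff 2 := by rw [leadingCoeff, hqd']
  have hKl : K.leadingCoeff = K.coeff 3 := by rw [leadingCoeff, hKd']
  have eq_ (t : ℝ) : q.eval t = pb.eval t * pc.eval t + pb.eval t * pd.eval t +
      pc.eval t * pd.eval t := by rw [hq]; simp
  have eK (t : ℝ) : K.eval t = 2 * q.eval t * pa.eval t +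
      (pb.eval t + pc.eval t + pd.eval t) * q.eval t + pb.eval t * pc.eval t * pd.eval t := by
    rw [eq_, hK]; simp
  have eF (t : ℝ) : F.eval t = pairedVamos (pa.eval t) (pb.eval t) (pc.eval t) (pd.eval t) := by
    rw [hF, pairedVamos, pairedVamos]; simp
  have eb (t : ℝ) : pb.eval t = xb + yb * t := by rw [hpb]; simp
  have ec (t : ℝ) : pc.eval t = xc + yc * t := by rw [hpc]; simp
  have ed (t : ℝ) : pd.eval t = xd + yd * t := by rw [hpd]; simp
  -- `q` is negative where `c + d` vanishes
  have hτ : q.eval (-(xc + xd) / (yc + yd)) < 0 := by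
    have h0 : (yc + yd) ≠ 0 := by positivity
    have h1 : pd.eval (-(xc + xd) / (yc + yd)) = -pc.eval (-(xc + xd) / (yc + yd)) := by
      rw [ec, ed]; field_simp; ring
    have h2 : pc.eval (-(xc + xd) / (yc + yd)) ≠ 0 := by
      rw [ec]
      intro h
      field_simp at h
      apply hcd
      linarith
    rw [eq_, h1]
    have := sq_pos_of_ne_zero h2
    linarith
  obtain ⟨ρ₁, ρ₂, hρ1, hρ2, hqf⟩ := exists_eq_C_mul_of_natDegree_two hqd' (hql ▸ hq2pos) hτ
  have hqe (t : ℝ) : q.eval t = q.leadingCoeff * ((t - ρ₁) * (t - ρ₂)) := by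
    conv_lhs => rw [hqf]
    simp
  have hρ12 := hρ1.trans hρ2
  rw [lt_div_iff₀ (by positivity)] at hρ1
  rw [div_lt_iff₀ (by positivity)] at hρ2
  -- At a root of `q`, `K = bcd` and `b(c + d) = -cd`. Hence `K` and `c + d` have opposite signs,
  -- and `c + d` changes sign between the two roots of `q`.
  have hKρ (t : ℝ) (ht : q.eval t = 0) : K.eval t * (pc.eval t + pd.eval t) =
      -(pc.eval t * pd.eval t) ^ 2 := by
    rw [eK, ht]
    rw [eq_] at ht
    linear_combination pc.eval t * pd.eval t * ht
  have hne (t : ℝ) (ht : q.eval t = 0) (h : pc.eval t + pd.eval t ≠ 0) :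
      pc.eval t * pd.eval t ≠ 0 := by
    intro h0
    rw [eq_, h0, add_zero, ← mul_add] at ht
    have hb0 := (mul_eq_zero.1 ht).resolve_right h
    rw [eb] at hb0
    rcases mul_eq_zero.1 h0 with h1 | h1
    · rw [ec] at h1
      apply hbc
      linear_combination yc * hb0 - yb * h1
    · rw [ed] at h1
      apply hbd
      linear_combination yd * hb0 - yb * h1
  have hq1 : q.eval ρ₁ = 0 := by rw [hqe]; ring
  have hq2 : q.eval ρ₂ = 0 := by rw [hqe]; ring
  have hK1 : 0 < K.eval ρ₁ := by
    have hs : pc.eval ρ₁ + pd.eval ρ₁ < 0 := by rw [ec, ed]; linarith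
    have h1 := hKρ _ hq1
    have h2 := sq_pos_of_ne_zero (hne _ hq1 hs.ne)
    by_contra! h
    nlinarith
  have hK2 : K.eval ρ₂ < 0 := by
    have hs : 0 < pc.eval ρ₂ + pd.eval ρ₂ := by rw [ec, ed]; linarith
    have h1 := hKρ _ hq2
    have h2 := sq_pos_of_ne_zero (hne _ hq2 hs.ne')
    by_contra! h
    nlinarith
  obtain ⟨t₁, t₂, t₃, h1, h2, h3, h4, k1, k2, k3⟩ :=
    exists_roots_of_natDegree_three hKd' (hKl ▸ hK3pos) hρ12 hK1 hK2
  -- Completing the square: `q F = K² + q c²d² - ((b + c)(b + d)(c + d))²`.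
  have hqF (t : ℝ) (ht : K.eval t = 0) : q.eval t * F.eval t ≤ 0 := by
    have hD := pairedVamos_discrim_nonneg (pb.eval t) (pc.eval t) (pd.eval t)
    rw [eK] at ht
    rw [eF, pairedVamos]
    rw [eq_] at ht ⊢
    generalize pa.eval t = a at *
    generalize pb.eval t = b at *
    generalize pc.eval t = c at *
    generalize pd.eval t = d at *
    have : (b * c + b * d + c * d) * (4 * (a + b + c + d) *
        (a * b * c + a * b * d + a * c * d + b * c * d) + c ^ 2 * d ^ 2) =
        (b * c + b * d + c * d) * (c ^ 2 * d ^ 2) - ((b + c) * (b + d) * (c + d)) ^ 2 := by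
      linear_combination (2 * (b * c + b * d + c * d) * a +
        (b + c + d) * (b * c + b * d + c * d) + b * c * d) * ht
    rw [this]
    linarith
  have hl : 0 < q.leadingCoeff := hql ▸ hq2pos
  have q1 : 0 < q.eval t₁ := by
    rw [hqe]
    exact mul_pos hl (mul_pos_of_neg_of_neg (by linarith) (by linarith))
  have q2 : q.eval t₂ < 0 := by
    rw [hqe]
    exact mul_neg_of_pos_of_neg hl (mul_neg_of_pos_of_neg (by linarith) (by linarith))
  have q3 : 0 < q.eval t₃ := by
    rw [hqe]
    exact mul_pos hl (mul_pos (by linarith) (by linarith))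
  -- At the roots of `K` the signs of `F` are only weak. Subtracting `ε q` makes them strict and
  -- leaves the quartic coefficient unchanged.
  have main (ε : ℝ) (hε : 0 < ε) :
      pairedVamos ya yb yc yd * |z.im| ^ 4 ≤ ‖aeval z F - ε * aeval z q‖ := by
    have hdeg : (F - C ε * q).natDegree ≤ 4 := by
      refine (natDegree_sub_le _ _).trans (max_le hFd ((natDegree_C_mul_le _ _).trans ?_))
      omega
    have hcoeff : (F - C ε * q).coeff 4 = pairedVamos ya yb yc yd := by
      rw [coeff_sub, hF4, coeff_C_mul, coeff_eq_zero_of_natDegree_lt (n := 4) (p := q) (by omega),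
        mul_zero, sub_zero]
    have hpos : 0 < (F - C ε * q).coeff 4 := by rw [hcoeff, ← hF4]; exact hF4pos
    have hdeg' : (F - C ε * q).natDegree = 4 :=
      natDegree_eq_of_le_of_coeff_ne_zero hdeg hpos.ne'
    have hlead : (F - C ε * q).leadingCoeff = pairedVamos ya yb yc yd := by
      rw [leadingCoeff, hdeg', hcoeff]
    have ev (t : ℝ) : (F - C ε * q).eval t = F.eval t - ε * q.eval t := by simp
    have := le_norm_aeval_of_sign_changes (P := F - C ε * q) hdeg' (by rw [hlead, ← hF4]; exact hF4pos)
      (h1.trans h2) (h3.trans h4)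
      (by rw [ev]; linarith [nonpos_of_mul_nonpos_right (hqF _ k1) q1, mul_pos hε q1])
      (by rw [ev]; linarith [nonneg_of_mul_nonpos_right (hqF _ k2) q2, mul_neg_of_pos_of_neg hε q2])
      (by rw [ev]; linarith [nonpos_of_mul_nonpos_right (hqF _ k3) q3, mul_pos hε q3]) z
    rw [hlead] at this
    simpa using this
  have hFz : pairedVamos ((xa : ℂ) + ya * z) (xb + yb * z) (xc + yc * z) (xd + yd * z) =
      aeval z F := by
    have h4 : aeval z (4 : ℝ[X]) = 4 := map_ofNat _ 4
    rw [hF, hpa, hpb, hpc, hpd, pairedVamos, pairedVamos]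
    simp [h4]
  rw [hFz]
  have hcont : Filter.Tendsto (fun ε : ℝ => ‖aeval z F - ε * aeval z q‖)
      (nhdsWithin 0 (Set.Ioi 0)) (nhds ‖aeval z F‖) := by
    have : Continuous fun ε : ℝ => ‖aeval z F - ε * aeval z q‖ := by fun_prop
    have h := this.tendsto 0
    simp only [Complex.ofReal_zero, zero_mul, sub_zero] at h
    exact h.mono_left nhdsWithin_le_nhds
  exact ge_of_tendsto hcont (Filter.eventually_of_mem self_mem_nhdsWithin main)

theorem eventually_add_mul_ne_zero (u : ℝ) {v : ℝ} (hv : v ≠ 0) :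
    ∀ᶠ ε in nhdsWithin (0 : ℝ) {0}ᶜ, u + ε * v ≠ 0 := by
  rcases eq_or_ne u 0 with rfl | hu
  · filter_upwards [self_mem_nhdsWithin] with ε hε
    simpa using ⟨hε, hv⟩
  · have hc : Continuous fun ε : ℝ => u + ε * v := by fun_prop
    have : ∀ᶠ ε in nhds (0 : ℝ), u + ε * v ≠ 0 := hc.continuousAt.eventually_ne (by simpa using hu)
    exact this.filter_mono nhdsWithin_le_nhds

theorem le_norm_pairedVamos_line {xa xb xc xd ya yb yc yd : ℝ} (ha : 0 < ya) (hb : 0 < yb)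
    (hc : 0 < yc) (hd : 0 < yd) (z : ℂ) :
    pairedVamos ya yb yc yd * |z.im| ^ 4 ≤
      ‖pairedVamos ((xa : ℂ) + ya * z) (xb + yb * z) (xc + yc * z) (xd + yd * z)‖ := by
  -- The zeros of the linear forms `b, c, d` on the line move by `-ε, -2ε, -3ε`, so they are
  -- distinct for small `ε ≠ 0`.
  have hcont : Continuous fun ε : ℝ => ‖pairedVamos ((xa : ℂ) + ya * z)
      ((xb + ε * yb : ℝ) + yb * z) ((xc + 2 * ε * yc : ℝ) + yc * z)
      ((xd + 3 * ε * yd : ℝ) + yd * z)‖ := by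
    unfold pairedVamos
    fun_prop
  have htend := (hcont.tendsto 0).mono_left (nhdsWithin_le_nhds (s := {0}ᶜ))
  simp only [zero_mul, mul_zero, add_zero] at htend
  refine ge_of_tendsto htend ?_
  filter_upwards [
    eventually_add_mul_ne_zero (xb * yc - xc * yb) (v := -(yb * yc)) (by simp [hb.ne', hc.ne']),
    eventually_add_mul_ne_zero (xb * yd - xd * yb) (v := -(2 * yb * yd))
      (by simp [hb.ne', hd.ne']),
    eventually_add_mul_ne_zero (xc * yd - xd * yc) (v := -(yc * yd)) (by simp [hc.ne', hd.ne'])]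
    with ε h1 h2 h3
  refine le_norm_pairedVamos_line_of_ne ha hb hc hd ?_ ?_ ?_ z
  · exact fun h => h1 (by linear_combination h)
  · exact fun h => h2 (by linear_combination h)
  · exact fun h => h3 (by linear_combination h)

theorem pairedVamos_pos {a b c d : ℝ} (ha : 0 < a) (hb : 0 < b) (hc : 0 < c) (hd : 0 < d) :
    0 < pairedVamos a b c d := by
  unfold pairedVamos; positivity

theorem pairedVamos_ne_zero {a b c d : ℂ} (ha : 0 < a.im) (hb : 0 < b.im) (hc : 0 < c.im)
    (hd : 0 < d.im) : pairedVamos a b c d ≠ 0 := by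
  have h := le_norm_pairedVamos_line (xa := a.re) (xb := b.re) (xc := c.re) (xd := d.re)
    ha hb hc hd Complex.I
  simp only [Complex.re_add_im, Complex.I_im, abs_one, one_pow, mul_one] at h
  exact norm_pos_iff.1 ((pairedVamos_pos ha hb hc hd).trans_le h)

/-! ### Two-variable Grace–Walsh–Szegő theorem -/

theorem Complex.im_pos_of_sub_eq_harmonic_mean {z₁ z₂ u v : ℂ} (h1 : 0 < z₁.im) (h2 : 0 < z₂.im)
    (hv : v.im ≤ 0) (h : u = v + ((((z₁ - v)⁻¹ + (z₂ - v)⁻¹) / 2))⁻¹) : 0 < u.im := by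
  obtain ⟨n₁, hn1⟩ : ∃ n, n = (z₁ - v)⁻¹ := ⟨_, rfl⟩
  obtain ⟨n₂, hn2⟩ : ∃ n, n = (z₂ - v)⁻¹ := ⟨_, rfl⟩
  -- The map `z ↦ (z - v)⁻¹` carries the upper half-plane into the region defined by this
  -- inequality, which is convex because `v.im ≤ 0`. So the mean of `n₁` and `n₂` stays in it.
  have key (z n : ℂ) (hz : 0 < z.im) (hn : n = (z - v)⁻¹) :
      0 < -n.im + v.im * Complex.normSq n := by
    have hzv : z - v ≠ 0 := fun h => by
      have := congrArg Complex.im h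
      simp at this
      linarith
    have hN : 0 < Complex.normSq (z - v) := Complex.normSq_pos.2 hzv
    rw [hn, Complex.inv_im, Complex.normSq_inv, Complex.sub_im]
    have : -(-(z.im - v.im) / Complex.normSq (z - v)) + v.im * (Complex.normSq (z - v))⁻¹ =
        z.im / Complex.normSq (z - v) := by field_simp; ring
    rw [this]
    positivity
  have k1 := key z₁ n₁ h1 hn1
  have k2 := key z₂ n₂ h2 hn2
  rw [← hn1, ← hn2] at h
  have hm : 0 < -((n₁ + n₂) / 2).im + v.im * Complex.normSq ((n₁ + n₂) / 2) := by
    have e1 : ((n₁ + n₂) / 2).im = (n₁.im + n₂.im) / 2 := by simp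
    have e2 : Complex.normSq ((n₁ + n₂) / 2) ≤ (Complex.normSq n₁ + Complex.normSq n₂) / 2 := by
      have : ((n₁ + n₂) / 2).re = (n₁.re + n₂.re) / 2 := by simp
      rw [Complex.normSq_apply, e1, this, Complex.normSq_apply, Complex.normSq_apply]
      nlinarith [sq_nonneg (n₁.re - n₂.re), sq_nonneg (n₁.im - n₂.im)]
    rw [e1]
    nlinarith [mul_le_mul_of_nonpos_left e2 hv]
  generalize (n₁ + n₂) / 2 = n at *
  have hn0 : n ≠ 0 := by rintro rfl; simp at hm
  have hN : 0 < Complex.normSq n := Complex.normSq_pos.2 hn0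
  rw [h, Complex.add_im, Complex.inv_im]
  have : v.im + -n.im / Complex.normSq n =
      (-n.im + v.im * Complex.normSq n) / Complex.normSq n := by field_simp; ring
  rw [this]
  positivity

/-- The Grace–Walsh–Szegő coincidence theorem for two variables and the upper half-plane. -/
theorem Complex.exists_im_pos_of_symmetric_biaffine {A B C z₁ z₂ : ℂ} (h1 : 0 < z₁.im)
    (h2 : 0 < z₂.im) (h : A * (z₁ * z₂) + B * (z₁ + z₂) + C = 0) :
    ∃ ξ : ℂ, 0 < ξ.im ∧ A * ξ ^ 2 + B * (2 * ξ) + C = 0 := by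
  rcases eq_or_ne A 0 with rfl | hA
  · refine ⟨(z₁ + z₂) / 2, ?_, by linear_combination h⟩
    have : ((z₁ + z₂) / 2).im = (z₁.im + z₂.im) / 2 := by simp
    rw [this]; positivity
  obtain ⟨w, hw⟩ := IsAlgClosed.exists_eq_mul_self (B ^ 2 - A * C)
  obtain ⟨u, hu⟩ : ∃ u, u = (-B + w) / A := ⟨_, rfl⟩
  obtain ⟨v, hv⟩ : ∃ v, v = (-B - w) / A := ⟨_, rfl⟩
  rw [eq_div_iff hA] at hu hv
  have hroot (r : ℂ) (hr : (r * A + B) ^ 2 = w * w) : A * r ^ 2 + B * (2 * r) + C = 0 := by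
    apply mul_left_cancel₀ hA
    linear_combination hr - hw
  rcases lt_or_ge 0 v.im with hvi | hvi
  · exact ⟨v, hvi, hroot v (by rw [hv]; ring)⟩
  refine ⟨u, Complex.im_pos_of_sub_eq_harmonic_mean h1 h2 hvi ?_, hroot u (by rw [hu]; ring)⟩
  have hp : z₁ - v ≠ 0 := fun h => by
    have := congrArg Complex.im h
    simp at this
    linarith
  have hq : z₂ - v ≠ 0 := fun h => by
    have := congrArg Complex.im h
    simp at this
    linarith
  -- Vanishing of the biaffine form says that the roots `u, v` of its diagonal are harmonically
  -- conjugate to `z₁, z₂`: `u - v` is the harmonic mean of `z₁ - v` and `z₂ - v`.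
  have key : 2 * ((z₁ - v) * (z₂ - v)) = (u - v) * ((z₁ - v) + (z₂ - v)) := by
    have hB : 2 * B = -(u + v) * A := by linear_combination hu + hv
    have hC : C = A * (u * v) := by
      apply mul_left_cancel₀ hA
      linear_combination -hw - v * A * hu - (-B + w) * hv
    apply mul_left_cancel₀ hA
    linear_combination 2 * h - (z₁ + z₂) * hB - 2 * hC
  generalize z₁ - v = p at *
  generalize z₂ - v = q at *
  have hpq : p + q ≠ 0 := by
    intro h0
    rw [h0, mul_zero] at key
    simp [hp, hq] at key
  have : ((p⁻¹ + q⁻¹) / 2)⁻¹ = u - v := by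
    have h3 : (p⁻¹ + q⁻¹) / 2 = (p + q) / (2 * (p * q)) := by field_simp; ring
    rw [h3, inv_div, key]
    field_simp
  rw [this]
  ring

/-! ### The basis polynomial and its real zero property -/

/-- The values of the bases generating polynomial of the Vámos cube. -/
def vamosForm {R : Type*} [CommRing R] (z : Fin 8 → R) : R :=
  (z 0 + z 3) * (z 1 + z 2) * (z 4 + z 5) * (z 6 + z 7) +
  z 0 * z 3 * ((z 1 + z 2) * (z 4 + z 5) + (z 1 + z 2) * (z 6 + z 7) +
    (z 4 + z 5) * (z 6 + z 7)) +
  z 1 * z 2 * ((z 0 + z 3) * (z 4 + z 5) + (z 0 + z 3) * (z 6 + z 7) +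
    (z 4 + z 5) * (z 6 + z 7)) +
  z 4 * z 5 * ((z 0 + z 3) * (z 1 + z 2) + (z 0 + z 3) * (z 6 + z 7) +
    (z 1 + z 2) * (z 6 + z 7)) +
  z 6 * z 7 * ((z 0 + z 3) * (z 1 + z 2) + (z 0 + z 3) * (z 4 + z 5) +
    (z 1 + z 2) * (z 4 + z 5)) +
  z 4 * z 5 * (z 6 * z 7)

theorem sum_powersetCard_four_prod {R : Type*} [CommRing R] (z : Fin 8 → R) :
    ∑ B ∈ Finset.powersetCard 4 Finset.univ, ∏ j ∈ B, z j =
      vamosForm z + ∑ B ∈ vamosPlanes, ∏ j ∈ B, z j := by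
  have h := Finset.esymm_map_val z (Finset.univ : Finset (Fin 8)) 4
  have hu : (Finset.univ : Finset (Fin 8)).val.map z =
      z 0 ::ₘ z 1 ::ₘ z 2 ::ₘ z 3 ::ₘ z 4 ::ₘ z 5 ::ₘ z 6 ::ₘ z 7 ::ₘ 0 := rfl
  rw [← h, hu]
  have hp : ∑ B ∈ vamosPlanes, ∏ j ∈ B, z j = z 0 * z 1 * z 2 * z 3 + z 0 * z 3 * z 4 * z 5 +
      z 0 * z 3 * z 6 * z 7 + z 1 * z 2 * z 4 * z 5 + z 1 * z 2 * z 6 * z 7 := by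
    unfold vamosPlanes
    repeat rw [Finset.sum_insert (by decide)]
    rw [Finset.sum_singleton]
    repeat rw [Finset.prod_insert (by decide)]
    simp only [Finset.prod_singleton]
    ring
  rw [hp]
  simp only [Multiset.esymm, Multiset.powersetCard_cons, Multiset.powersetCard_zero_left,
    Multiset.powersetCard_zero_right, Multiset.map_add, Multiset.map_zero,
    Multiset.map_singleton, Multiset.prod_cons, Multiset.prod_zero,
    Multiset.sum_add, Multiset.sum_singleton, zero_add, add_zero, mul_one]
  unfold vamosForm
  ring

theorem vamosCube_isBase_iff (B : Finset (Fin 8)) :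
    vamosCube.IsBase (B : Set (Fin 8)) ↔ B.card = 4 ∧ B ∉ vamosPlanes := by
  have : vamosCube.IsBase (B : Set (Fin 8)) ↔ IsVamosBasis B := by simp [vamosCube]
  rw [this, IsVamosBasis, Set.ncard_coe_finset]
  refine and_congr_right fun _ => ⟨fun h hB => h B hB rfl, fun h P hP e => h ?_⟩
  rwa [Finset.coe_injective e]

open scoped Classical in
theorem basesGeneratingPolynomial_eq_sum_finset {σ : Type*} [Fintype σ] (M : Matroid σ) :
    basesGeneratingPolynomial M =
      ∑ B ∈ (Finset.univ : Finset (Finset σ)).filter fun B : Finset σ => M.IsBase (B : Set σ),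
        ∏ j ∈ B, MvPolynomial.X j := by
  rw [basesGeneratingPolynomial]
  symm
  refine Finset.sum_bij (fun B _ => (B : Set σ)) ?_ ?_ ?_ ?_
  · intro B hB
    simpa using hB
  · intro B _ B' _ hBB'
    exact Finset.coe_injective hBB'
  · intro S hS
    rw [Finset.mem_filter] at hS
    refine ⟨S.toFinset, ?_, Set.coe_toFinset S⟩
    simpa using hS.2
  · intro B _
    simp

theorem aeval_basesGeneratingPolynomial_vamosCube {R : Type*} [CommRing R] [Algebra ℝ R]
    (z : Fin 8 → R) :
    MvPolynomial.aeval z (basesGeneratingPolynomial vamosCube) = vamosForm z := by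
  have hsub : vamosPlanes ⊆ Finset.powersetCard 4 Finset.univ := by decide
  have h := Finset.sum_sdiff (f := fun B => ∏ j ∈ B, z j) hsub
  rw [sum_powersetCard_four_prod, add_left_inj] at h
  rw [← h, basesGeneratingPolynomial_eq_sum_finset, map_sum]
  simp only [map_prod, MvPolynomial.aeval_X]
  congr 1
  ext B
  simp [vamosCube_isBase_iff]

theorem aeval_shiftedVamosPolynomial {R : Type*} [CommRing R] [Algebra ℝ R] (z : Fin 8 → R) :
    MvPolynomial.aeval z shiftedVamosPolynomial = vamosForm fun i => z i + 1 := by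
  rw [shiftedVamosPolynomial, MvPolynomial.aeval_bind₁, aeval_basesGeneratingPolynomial_vamosCube]
  simp

theorem vamosForm_ne_zero {z : Fin 8 → ℂ} (hz : ∀ i, 0 < (z i).im) : vamosForm z ≠ 0 := by
  intro h
  unfold vamosForm at h
  obtain ⟨a, ha, h⟩ := Complex.exists_im_pos_of_symmetric_biaffine (hz 0) (hz 3)
    (A := (z 1 + z 2) * (z 4 + z 5) + (z 1 + z 2) * (z 6 + z 7) + (z 4 + z 5) * (z 6 + z 7))
    (B := (z 1 + z 2) * (z 4 + z 5) * (z 6 + z 7) +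
      z 1 * z 2 * ((z 4 + z 5) + (z 6 + z 7)) + z 4 * z 5 * ((z 1 + z 2) + (z 6 + z 7)) +
      z 6 * z 7 * ((z 1 + z 2) + (z 4 + z 5)))
    (C := z 1 * z 2 * ((z 4 + z 5) * (z 6 + z 7)) + z 4 * z 5 * ((z 1 + z 2) * (z 6 + z 7)) +
      z 6 * z 7 * ((z 1 + z 2) * (z 4 + z 5)) + z 4 * z 5 * (z 6 * z 7))
    (by linear_combination h)
  obtain ⟨b, hb, h⟩ := Complex.exists_im_pos_of_symmetric_biaffine (hz 1) (hz 2)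
    (A := (2 * a) * (z 4 + z 5) + (2 * a) * (z 6 + z 7) + (z 4 + z 5) * (z 6 + z 7))
    (B := (2 * a) * (z 4 + z 5) * (z 6 + z 7) +
      a ^ 2 * ((z 4 + z 5) + (z 6 + z 7)) + z 4 * z 5 * ((2 * a) + (z 6 + z 7)) +
      z 6 * z 7 * ((2 * a) + (z 4 + z 5)))
    (C := a ^ 2 * ((z 4 + z 5) * (z 6 + z 7)) + z 4 * z 5 * ((2 * a) * (z 6 + z 7)) +
      z 6 * z 7 * ((2 * a) * (z 4 + z 5)) + z 4 * z 5 * (z 6 * z 7))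
    (by linear_combination h)
  obtain ⟨c, hc, h⟩ := Complex.exists_im_pos_of_symmetric_biaffine (hz 4) (hz 5)
    (A := (2 * a) * (2 * b) + (2 * a) * (z 6 + z 7) + (2 * b) * (z 6 + z 7) + z 6 * z 7)
    (B := (2 * a) * (2 * b) * (z 6 + z 7) +
      a ^ 2 * ((2 * b) + (z 6 + z 7)) + b ^ 2 * ((2 * a) + (z 6 + z 7)) +
      z 6 * z 7 * ((2 * a) + (2 * b)))
    (C := a ^ 2 * ((2 * b) * (z 6 + z 7)) + b ^ 2 * ((2 * a) * (z 6 + z 7)) +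
      z 6 * z 7 * ((2 * a) * (2 * b)))
    (by linear_combination h)
  obtain ⟨d, hd, h⟩ := Complex.exists_im_pos_of_symmetric_biaffine (hz 6) (hz 7)
    (A := (2 * a) * (2 * b) + (2 * a) * (2 * c) + (2 * b) * (2 * c) + c ^ 2)
    (B := (2 * a) * (2 * b) * (2 * c) +
      a ^ 2 * ((2 * b) + (2 * c)) + b ^ 2 * ((2 * a) + (2 * c)) +
      c ^ 2 * ((2 * a) + (2 * b)))
    (C := a ^ 2 * ((2 * b) * (2 * c)) + b ^ 2 * ((2 * a) * (2 * c)) +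
      c ^ 2 * ((2 * a) * (2 * b)))
    (by linear_combination h)
  refine pairedVamos_ne_zero ha hb hc hd ?_
  unfold pairedVamos
  linear_combination h

theorem isRealZero_shiftedVamosPolynomial : IsRealZero shiftedVamosPolynomial := by
  intro x μ h
  rw [aeval_shiftedVamosPolynomial] at h
  by_contra hμ
  have hμ0 : μ ≠ 0 := by rintro rfl; simp at hμ
  have hinv : (μ⁻¹).im ≠ 0 := by
    rw [Complex.inv_im]
    exact div_ne_zero (neg_ne_zero.2 hμ) (Complex.normSq_pos.2 hμ0).ne'
  have hscale (s : ℂ) : vamosForm (fun i => s * (μ * x i + 1)) = 0 := by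
    -- Homogeneity of degree 4. Taking `s = ±μ⁻¹` turns the point into `±x i ± μ⁻¹`, with all
    -- imaginary parts equal and, for the right sign, positive.
    have : vamosForm (fun i => s * (μ * x i + 1)) =
        s ^ 4 * vamosForm (fun i => μ * x i + 1) := by
      unfold vamosForm; ring
    rw [this, h, mul_zero]
  rcases lt_or_gt_of_ne hinv with h0 | h0
  · refine vamosForm_ne_zero (fun i => ?_) (hscale (-μ⁻¹))
    have : -μ⁻¹ * (μ * x i + 1) = ((-x i : ℝ) : ℂ) + -μ⁻¹ := by push_cast; field_simp; ring
    rw [this, Complex.add_im, Complex.ofReal_im, Complex.neg_im]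
    linarith
  · refine vamosForm_ne_zero (fun i => ?_) (hscale μ⁻¹)
    have : μ⁻¹ * (μ * x i + 1) = (x i : ℂ) + μ⁻¹ := by field_simp
    rw [this, Complex.add_im, Complex.ofReal_im]
    linarith

/-! ### Ingleton's inequality and ranks of semidefinite pencils -/

/-- Ingleton's inequality for the dimensions of intersections of four subspaces. -/
theorem Submodule.finrank_inf_ingleton {K V : Type*} [DivisionRing K] [AddCommGroup V] [Module K V]
    [FiniteDimensional K V] (a b c d : Submodule K V) :
    Module.finrank K ↥(a ⊓ b) + Module.finrank K ↥(a ⊓ c) + Module.finrank K ↥(a ⊓ d) +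
      Module.finrank K ↥(b ⊓ c) + Module.finrank K ↥(b ⊓ d) ≤
    Module.finrank K a + Module.finrank K b + Module.finrank K ↥(c ⊓ d) +
      Module.finrank K ↥(a ⊓ b ⊓ c) + Module.finrank K ↥(a ⊓ b ⊓ d) := by
  have h1 := Submodule.finrank_sup_add_finrank_inf_eq a b
  have key (e : Submodule K V) : Module.finrank K ↥(a ⊓ e) + Module.finrank K ↥(b ⊓ e) ≤
      Module.finrank K ↥((a ⊔ b) ⊓ e) + Module.finrank K ↥(a ⊓ b ⊓ e) := by
    rw [← Submodule.finrank_sup_add_finrank_inf_eq]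
    refine add_le_add (Submodule.finrank_mono ?_) (Submodule.finrank_mono ?_)
    · exact sup_le (inf_le_inf_right _ le_sup_left) (inf_le_inf_right _ le_sup_right)
    · exact le_inf (inf_le_inf inf_le_left inf_le_left) (inf_le_left.trans inf_le_right)
  have h2 : Module.finrank K ↥((a ⊔ b) ⊓ c) + Module.finrank K ↥((a ⊔ b) ⊓ d) ≤
      Module.finrank K ↥(a ⊔ b) + Module.finrank K ↥(c ⊓ d) := by
    rw [← Submodule.finrank_sup_add_finrank_inf_eq]
    refine add_le_add (Submodule.finrank_mono ?_) (Submodule.finrank_mono ?_)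
    · exact sup_le inf_le_left inf_le_left
    · exact inf_le_inf inf_le_right inf_le_right
  have hc := key c
  have hd := key d
  omega

-- If `x* (A + B) x = 0`, both nonnegative summands vanish, and for a semidefinite matrix this puts
-- `x` in the kernel.
open scoped ComplexOrder in
theorem Matrix.PosSemidef.ker_mulVecLin_add {n : Type*} [Fintype n] [DecidableEq n]
    {A B : Matrix n n ℂ} (hA : A.PosSemidef) (hB : B.PosSemidef) :
    LinearMap.ker (A + B).mulVecLin = LinearMap.ker A.mulVecLin ⊓ LinearMap.ker B.mulVecLin := by
  ext x
  simp only [LinearMap.mem_ker, Matrix.mulVecLin_apply, Submodule.mem_inf]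
  rw [← hA.dotProduct_mulVec_zero_iff, ← hB.dotProduct_mulVec_zero_iff,
    ← (hA.add hB).dotProduct_mulVec_zero_iff, Matrix.add_mulVec, dotProduct_add]
  refine ⟨fun h => ?_, fun h => by rw [h.1, h.2, add_zero]⟩
  exact (add_eq_zero_iff_of_nonneg (hA.dotProduct_mulVec_nonneg x)
    (hB.dotProduct_mulVec_nonneg x)).1 h

theorem Matrix.finrank_ker_mulVecLin_add_rank {n : ℕ} (A : Matrix (Fin n) (Fin n) ℂ) :
    Module.finrank ℂ (LinearMap.ker A.mulVecLin) + A.rank = n := by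
  have := LinearMap.finrank_range_add_finrank_ker A.mulVecLin
  rw [Module.finrank_fin_fun] at this
  rw [Matrix.rank]
  omega

theorem Matrix.IsHermitian.det_one_add_smul {n : Type*} [Fintype n] [DecidableEq n]
    {A : Matrix n n ℂ} (hA : A.IsHermitian) (t : ℂ) :
    (1 + t • A).det = ∏ i, (1 + t * (hA.eigenvalues i : ℂ)) := by
  have h : 1 + t • A = Unitary.conjStarAlgAut ℂ _ hA.eigenvectorUnitary
      (1 + t • Matrix.diagonal (RCLike.ofReal ∘ hA.eigenvalues)) := by
    rw [map_add, map_smul, map_one, ← hA.spectral_theorem]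
  rw [h, Unitary.conjStarAlgAut_apply, Matrix.det_mul_right_comm, Unitary.mul_star_self_of_mem hA.eigenvectorUnitary.2,
    one_mul,
    ← Matrix.diagonal_one, ← Matrix.diagonal_smul, Matrix.diagonal_add, Matrix.det_diagonal]
  rfl

open scoped ComplexOrder in
theorem Matrix.IsHermitian.posSemidef_of_det_one_add_smul_ne_zero {n : Type*} [Fintype n]
    [DecidableEq n] {A : Matrix n n ℂ} (hA : A.IsHermitian)
    (h : ∀ t : ℝ, 0 < t → (1 + (t : ℂ) • A).det ≠ 0) : A.PosSemidef := by
  rw [hA.posSemidef_iff_eigenvalues_nonneg]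
  intro i
  by_contra! hi
  simp only [Pi.zero_apply] at hi
  refine h (-(hA.eigenvalues i)⁻¹) (neg_pos.2 (inv_lt_zero.2 hi)) ?_
  rw [hA.det_one_add_smul]
  refine Finset.prod_eq_zero (Finset.mem_univ i) ?_
  have : (hA.eigenvalues i : ℂ) ≠ 0 := by exact_mod_cast hi.ne
  push_cast
  field_simp
  ring

-- By the spectral theorem the determinant is `∏ (1 + t λᵢ)`, whose degree counts the nonzero
-- eigenvalues.
open Polynomial in
theorem Matrix.IsHermitian.rank_eq_natDegree {n : Type*} [Fintype n] [DecidableEq n]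
    {A : Matrix n n ℂ} (hA : A.IsHermitian) {P : ℂ[X]}
    (h : ∀ t, (1 + t • A).det = P.eval t) : A.rank = P.natDegree := by
  have hP : P = ∏ i, (1 + C (hA.eigenvalues i : ℂ) * X) := by
    refine Polynomial.funext fun t => ?_
    rw [← h, hA.det_one_add_smul, eval_prod]
    simp only [eval_add, eval_one, eval_mul, eval_C, eval_X, mul_comm]
  rw [hP, natDegree_prod, hA.rank_eq_card_non_zero_eigs, Fintype.card_subtype, Finset.card_filter]
  · refine Finset.sum_congr rfl fun i _ => ?_
    split_ifs with hi
    · rw [add_comm, ← C_1, natDegree_linear (by exact_mod_cast hi)]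
    · rw [not_not] at hi
      rw [hi, Complex.ofReal_zero, C_0, zero_mul, add_zero, natDegree_one]
  · intro i _ h0
    have := congrArg (eval 0) h0
    simp only [eval_add, eval_one, eval_mul, eval_X, mul_zero, add_zero, eval_zero] at this
    exact one_ne_zero this

open Polynomial in
theorem Matrix.IsHermitian.rank_eq_mul_natDegree {m N : ℕ} {M : Matrix (Fin m) (Fin m) ℂ}
    (hM : M.IsHermitian) {k : ℂ} (hk : k ≠ 0) (P : ℂ[X])
    (h : ∀ t, (1 + t • M).det = k * (P.eval t) ^ N) : M.rank = N * P.natDegree := by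
  rw [hM.rank_eq_natDegree (P := C k * P ^ N) (by simpa using h), natDegree_C_mul hk,
    natDegree_pow]

theorem pairedVamos_ofReal (a b c d : ℝ) :
    pairedVamos (a : ℂ) b c d = (pairedVamos a b c d : ℝ) := by
  unfold pairedVamos; push_cast; rfl

open Polynomial in
open scoped ComplexOrder in
theorem det_pencil_ne_pairedVamos_pow {m N : ℕ} (hN : 0 < N) {k : ℂ}
    {A B C D : Matrix (Fin m) (Fin m) ℂ} (hA : A.IsHermitian) (hB : B.IsHermitian)
    (hC : C.IsHermitian) (hD : D.IsHermitian) :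
    ¬ ∀ a b c d : ℂ, (1 + a • A + b • B + c • C + d • D).det =
      k * pairedVamos (a + 1) (b + 1) (c + 1) (d + 1) ^ N := by
  intro h
  have hk : k ≠ 0 := by
    rintro rfl
    simpa using h 0 0 0 0
  have hpos (a b c d : ℝ) (ha : 0 ≤ a) (hb : 0 ≤ b) (hc : 0 ≤ c) (hd : 0 ≤ d) :
      k * pairedVamos ((a : ℂ) + 1) (b + 1) (c + 1) (d + 1) ^ N ≠ 0 := by
    refine mul_ne_zero hk (pow_ne_zero _ ?_)
    have := pairedVamos_ofReal (a + 1) (b + 1) (c + 1) (d + 1)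
    push_cast at this
    rw [this]
    exact_mod_cast (pairedVamos_pos (by linarith) (by linarith) (by linarith) (by linarith)).ne'
  have pA : A.PosSemidef := hA.posSemidef_of_det_one_add_smul_ne_zero fun t ht => by
    have := hpos t 0 0 0 ht.le le_rfl le_rfl le_rfl
    rw [← h] at this
    simpa using this
  have pB : B.PosSemidef := hB.posSemidef_of_det_one_add_smul_ne_zero fun t ht => by
    have := hpos 0 t 0 0 le_rfl ht.le le_rfl le_rfl
    rw [← h] at this
    simpa using this
  have pC : C.PosSemidef := hC.posSemidef_of_det_one_add_smul_ne_zero fun t ht => by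
    have := hpos 0 0 t 0 le_rfl le_rfl ht.le le_rfl
    rw [← h] at this
    simpa using this
  have pD : D.PosSemidef := hD.posSemidef_of_det_one_add_smul_ne_zero fun t ht => by
    have := hpos 0 0 0 t le_rfl le_rfl le_rfl ht.le
    rw [← h] at this
    simpa using this
  have rA : A.rank = N * 2 := by
    have hd : (pairedVamos (X + 1) 1 1 1 : ℂ[X]).natDegree = 2 := by
      unfold pairedVamos; compute_degree!
    rw [← hd]
    refine hA.rank_eq_mul_natDegree hk _ fun t => ?_
    simpa [pairedVamos] using h t 0 0 0
  have rB : B.rank = N * 2 := by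
    have hd : (pairedVamos 1 (X + 1) 1 1 : ℂ[X]).natDegree = 2 := by
      unfold pairedVamos; compute_degree!
    rw [← hd]
    refine hB.rank_eq_mul_natDegree hk _ fun t => ?_
    simpa [pairedVamos] using h 0 t 0 0
  have rAB : (A + B).rank = N * 3 := by
    have hd : (pairedVamos (X + 1) (X + 1) 1 1 : ℂ[X]).natDegree = 3 := by
      unfold pairedVamos; compute_degree!
    rw [← hd]
    refine (hA.add hB).rank_eq_mul_natDegree hk _ fun t => ?_
    simpa [pairedVamos, add_assoc] using h t t 0 0
  have rAC : (A + C).rank = N * 3 := by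
    have hd : (pairedVamos (X + 1) 1 (X + 1) 1 : ℂ[X]).natDegree = 3 := by
      unfold pairedVamos; compute_degree!
    rw [← hd]
    refine (hA.add hC).rank_eq_mul_natDegree hk _ fun t => ?_
    simpa [pairedVamos, add_assoc] using h t 0 t 0
  have rAD : (A + D).rank = N * 3 := by
    have hd : (pairedVamos (X + 1) 1 1 (X + 1) : ℂ[X]).natDegree = 3 := by
      unfold pairedVamos; compute_degree!
    rw [← hd]
    refine (hA.add hD).rank_eq_mul_natDegree hk _ fun t => ?_
    simpa [pairedVamos, add_assoc] using h t 0 0 t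
  have rBC : (B + C).rank = N * 3 := by
    have hd : (pairedVamos 1 (X + 1) (X + 1) 1 : ℂ[X]).natDegree = 3 := by
      unfold pairedVamos; compute_degree!
    rw [← hd]
    refine (hB.add hC).rank_eq_mul_natDegree hk _ fun t => ?_
    simpa [pairedVamos, add_assoc] using h 0 t t 0
  have rBD : (B + D).rank = N * 3 := by
    have hd : (pairedVamos 1 (X + 1) 1 (X + 1) : ℂ[X]).natDegree = 3 := by
      unfold pairedVamos; compute_degree!
    rw [← hd]
    refine (hB.add hD).rank_eq_mul_natDegree hk _ fun t => ?_
    simpa [pairedVamos, add_assoc] using h 0 t 0 t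
  have rCD : (C + D).rank = N * 4 := by
    have hd : (pairedVamos 1 1 (X + 1) (X + 1) : ℂ[X]).natDegree = 4 := by
      unfold pairedVamos; compute_degree!
    rw [← hd]
    refine (hC.add hD).rank_eq_mul_natDegree hk _ fun t => ?_
    simpa [pairedVamos, add_assoc] using h 0 0 t t
  have rABC : (A + B + C).rank = N * 4 := by
    have hd : (pairedVamos (X + 1) (X + 1) (X + 1) 1 : ℂ[X]).natDegree = 4 := by
      unfold pairedVamos; compute_degree!
    rw [← hd]
    refine ((hA.add hB).add hC).rank_eq_mul_natDegree hk _ fun t => ?_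
    simpa [pairedVamos, add_assoc] using h t t t 0
  have rABD : (A + B + D).rank = N * 4 := by
    have hd : (pairedVamos (X + 1) (X + 1) 1 (X + 1) : ℂ[X]).natDegree = 4 := by
      unfold pairedVamos; compute_degree!
    rw [← hd]
    refine ((hA.add hB).add hD).rank_eq_mul_natDegree hk _ fun t => ?_
    simpa [pairedVamos, add_assoc] using h t t 0 t
  have hI := Submodule.finrank_inf_ingleton (LinearMap.ker A.mulVecLin)
    (LinearMap.ker B.mulVecLin) (LinearMap.ker C.mulVecLin) (LinearMap.ker D.mulVecLin)
  rw [← pA.ker_mulVecLin_add pB, ← pA.ker_mulVecLin_add pC, ← pA.ker_mulVecLin_add pD,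
    ← pB.ker_mulVecLin_add pC, ← pB.ker_mulVecLin_add pD, ← pC.ker_mulVecLin_add pD,
    ← (pA.add pB).ker_mulVecLin_add pC, ← (pA.add pB).ker_mulVecLin_add pD] at hI
  have dA := A.finrank_ker_mulVecLin_add_rank
  have dB := B.finrank_ker_mulVecLin_add_rank
  have dAB := (A + B).finrank_ker_mulVecLin_add_rank
  have dAC := (A + C).finrank_ker_mulVecLin_add_rank
  have dAD := (A + D).finrank_ker_mulVecLin_add_rank
  have dBC := (B + C).finrank_ker_mulVecLin_add_rank
  have dBD := (B + D).finrank_ker_mulVecLin_add_rank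
  have dCD := (C + D).finrank_ker_mulVecLin_add_rank
  have dABC := (A + B + C).finrank_ker_mulVecLin_add_rank
  have dABD := (A + B + D).finrank_ker_mulVecLin_add_rank
  -- Ingleton would give `5m - 15N ≤ 5m - 16N`: the left side has five ranks `3N`, the right side
  -- two ranks `2N` and three ranks `4N`.
  omega

/-! ### Transfer to the Vámos cube and the conjecture -/

theorem eval_detPencil {n m : ℕ} {R : Type*} [CommRing R] (A : Fin n → Matrix (Fin m) (Fin m) R)
    (x : Fin n → R) : MvPolynomial.eval x (detPencil A) = (1 + ∑ i, x i • A i).det := by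
  rw [detPencil, RingHom.map_det]
  congr 1
  ext i j
  simp [Matrix.add_apply, Matrix.sum_apply, Matrix.one_apply, apply_ite]

theorem not_hasHermitianDetRep_pow {N : ℕ} (hN : 0 < N) (c : ℝ) :
    ¬ HasHermitianDetRep (MvPolynomial.C c * shiftedVamosPolynomial ^ N) := by
  rintro ⟨m, A, hA, h⟩
  refine det_pencil_ne_pairedVamos_pow hN (k := c) ((hA 0).add (hA 3)) ((hA 1).add (hA 2))
    ((hA 4).add (hA 5)) ((hA 6).add (hA 7)) fun x y z w => ?_
  have h' := congrArg (MvPolynomial.eval ![x, y, y, x, z, z, w, w]) h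
  rw [eval_detPencil, MvPolynomial.eval_map, ← MvPolynomial.aeval_def, map_mul, map_pow,
    aeval_shiftedVamosPolynomial, MvPolynomial.aeval_C] at h'
  have hv : vamosForm (fun i => (![x, y, y, x, z, z, w, w] : Fin 8 → ℂ) i + 1) =
      pairedVamos (x + 1) (y + 1) (z + 1) (w + 1) := by
    simp only [vamosForm, pairedVamos, Matrix.cons_val]
    ring
  rw [hv] at h'
  refine Eq.trans ?_ h'.symm
  congr 1
  simp only [Fin.sum_univ_eight, Matrix.cons_val, smul_add]
  abel

theorem HasSymmetricDetRep.hasHermitianDetRep {n : ℕ} {q : MvPolynomial (Fin n) ℝ}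
    (h : HasSymmetricDetRep q) : HasHermitianDetRep q := by
  obtain ⟨m, A, hA, rfl⟩ := h
  refine ⟨m, fun i => (A i).map (algebraMap ℝ ℂ), fun i => ?_, ?_⟩
  · ext j k
    simp [Matrix.conjTranspose_apply, (hA i).apply]
  · rw [detPencil, detPencil, RingHom.map_det]
    congr 1
    ext1 i j
    simp [Matrix.add_apply, Matrix.sum_apply, Matrix.one_apply, apply_ite]

theorem not_relaxedHeltonVinnikovConjecture : ¬ RelaxedHeltonVinnikovConjecture := by
  intro h
  -- The value is the number of bases, `70 - 5`.
  have h0 : MvPolynomial.eval 0 shiftedVamosPolynomial = 65 := by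
    have e (p : MvPolynomial (Fin 8) ℝ) : MvPolynomial.eval 0 p = MvPolynomial.aeval 0 p := by
      rw [MvPolynomial.aeval_def]; rfl
    rw [e, aeval_shiftedVamosPolynomial, vamosForm]
    simp only [Pi.zero_apply]
    norm_num
  obtain ⟨N, hN, hrep⟩ := h 8 (MvPolynomial.C (1 / 65) * shiftedVamosPolynomial)
    (fun x μ hx => isRealZero_shiftedVamosPolynomial x μ (by simpa using hx)) 
    (by rw [map_mul, MvPolynomial.eval_C, h0]; norm_num)
  rw [mul_pow, ← map_pow] at hrep
  exact not_hasHermitianDetRep_pow hN _ hrep.hasHermitianDetRep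

theorem mainTheorem1 :
    IsRealZero shiftedVamosPolynomial ∧
    (∀ (N : ℕ) (c : ℝ), 0 < N →
      ¬ HasHermitianDetRep (MvPolynomial.C c * shiftedVamosPolynomial ^ N) ∧
      ¬ HasSymmetricDetRep (MvPolynomial.C c * shiftedVamosPolynomial ^ N)) ∧
    ¬ RelaxedHeltonVinnikovConjecture :=
  ⟨isRealZero_shiftedVamosPolynomial,
    fun _ c hN => ⟨not_hasHermitianDetRep_pow hN c,
      fun h => not_hasHermitianDetRep_pow hN c h.hasHermitianDetRep⟩,
    not_relaxedHeltonVinnikovConjecture⟩
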